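/- Throughout $\mathbb N=\{1,2,\dots\}$, $\mathbb N_0=\mathbb N\cup\{0\}$, and $\ell_\infty(\mathbb N)$, $\ell_\infty(\mathbb N^2)$ are the real spaces of bounded functions with the supremum norm. **Parameters.** For $M>16$ and $k=1,\dots,8$ put $$x_k=\frac{\frac12+\frac kM}{1-\frac{2k}M},\quad t(k)=\frac12-\frac kM,\quad u(k)=1-x_8+x_k,\quad v(k)=1+x_1^2-x_k^2,\quad \delta_M=x_8^2-x_1^2,$$ $$\mu_M=\min_{j,k\in\{1,\dots,8\},\,j\ne k}\big\{(1-t(k))(u(k)-u(j))+t(k)(v(k)-v(j))\big\}.$$ Let $\delta,\Delta>0$ and $M>16$ be real numbers satisfying $$\delta<\tfrac1{10},\quad \tfrac8M+\delta_M+\mu_M<\tfrac{1-8\delta}6,\quad \delta_M<\tfrac\delta3,\quad \Delta<\min\Big\{\tfrac{\mu_M}2,\ \tfrac\delta6,\ \tfrac{1-2\delta}3-\delta_M,\ \delta_M,\ \tfrac{1-\delta_M}2\Big\}.$$ Write $\delta_i(k)=\Delta$ if $k=i$ and $\delta_i(k)=0$ otherwise. Let $(e_n)_{n\in\mathbb N}$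 be norm-one vectors of $\ell_\infty(\mathbb N)$ with $\|\sum_n\lambda_ne_n\|=\sum_n|\lambda_n|$ for all finitely supported real sequences $(\lambda_n)$. **The space.** For $i=1,2$ and $n\in\mathbb N$ define $U_i,V_{i,n}\in\ell_\infty(\mathbb N^2)$ as follows, where $m\in\mathbb N_0$ and $k\in\{1,\dots,8\}$: $$U_i(1,8m+k)=\begin{cases}u(k)& m\equiv i-1 \pmod 2,\\ \delta_8(k)&\text{otherwise,}\end{cases}\qquad U_i(p,q)=\tfrac1{10}e_1(q)\quad(p\ge2,\ q\in\mathbb N);$$ $$V_{i,n}(1,8m+k)=\begin{cases}(-1)^{i-1}\big(\frac{1-\delta}3-\delta_{i+1}(k)\big)& m=n,\\ v(k)-\frac{2+2\delta}3+(-1)^i\delta_7(k)& m=n+1,\\ (-1)^{i-1}\big(\frac{1-2\delta}3-\delta_6(k)\big)& m\equiv n \pmod 2,\ m\neq n,\\ 0&\text{otherwise;}\end{cases}$$ and, for $p\ge2$ and $q\in\mathbb N$, $$V_{i,n}(p,q)=\begin{cases}(-1)^{i-1}\frac{1-\delta}3e_1(q)& p=2n+i-1,\\ 0& p\in\{2n+2,2n+3\},\\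 \frac1{10}e_{2n+i-1}(q)&\text{otherwise.}\end{cases}$$ Let $X$ be the closed linear span in $\ell_\infty(\mathbb N^2)$ of $\{U_1,U_2\}\cup\{V_{i,n}: i=1,2,\ n\in\mathbb N\}$. **Theorem.** There are $0<\varepsilon_0<\frac1{10}$ and $C>0$ with the following property. Let $D$ be a convex subset of $X$ with $0\in D$, and let $R:X\to X$ be a $(1+\varepsilon_0/C)$-Lipschitz retraction onto $D$ (that is, $R(X)\subseteq D$ and $R(x)=x$ for all $x\in D$) such that for $i,j=1,2$ $$\|R((-1)^jV_{i,1})-(-1)^jV_{i,1}\|\le\varepsilon_0,\qquad \|R((-1)^jU_i)-(-1)^jU_i\|\le\varepsilon_0 .$$ Then $\|R((-1)^jV_{i,n})-(-1)^jV_{i,n}\|\le\varepsilon_0$ for all $i,j\in\{1,2\}$ and $n\in\mathbb N$. -/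

import Mathlib

open scoped ENNReal

noncomputable section

namespace RetractSpace

/-- `ℓ_∞(ℕ)` with `ℕ = {1, 2, …}`. -/
abbrev LInf : Type := lp (fun _ : ℕ+ => ℝ) ∞

/-- `ℓ_∞(ℕ²)` with `ℕ = {1, 2, …}`. -/
abbrev LInf2 : Type := lp (fun _ : ℕ+ × ℕ+ => ℝ) ∞

/-- The sequence `e 1, e 2, …` (the value `e 0` is not used) consists of normalised vectors and is
isometrically equivalent to the unit vector basis of `ℓ_1`. -/
def IsEllOneBasis (e : ℕ → LInf) : Prop :=
  (∀ n, 1 ≤ n → ‖e n‖ = 1) ∧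
    ∀ (N : ℕ) (a : ℕ → ℝ),
      ‖∑ n ∈ Finset.Icc 1 N, a n • e n‖ = ∑ n ∈ Finset.Icc 1 N, |a n|

/-! The scalar data; the index `k` ranges over `1, …, 8`. -/

/-- `x_k = (1/2 + k/M) / (1 - 2k/M)`. -/
def xk (M : ℝ) (k : ℕ) : ℝ := (1 / 2 + k / M) / (1 - 2 * k / M)

/-- `t(k) = 1/2 - k/M`. -/
def tk (M : ℝ) (k : ℕ) : ℝ := 1 / 2 - k / M

/-- `u(k) = α + x_k` with `α = 1 - x_8`. -/
def u (M : ℝ) (k : ℕ) : ℝ := (1 - xk M 8) + xk M k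

/-- `v(k) = β - x_k ^ 2` with `β = 1 + x_1 ^ 2`. -/
def v (M : ℝ) (k : ℕ) : ℝ := (1 + xk M 1 ^ 2) - xk M k ^ 2

/-- `δ_M = x_8 ^ 2 - x_1 ^ 2`. -/
def deltaM (M : ℝ) : ℝ := xk M 8 ^ 2 - xk M 1 ^ 2

theorem offDiag_nonempty : (Finset.Icc 1 8 : Finset ℕ).offDiag.Nonempty := ⟨(1, 2), by decide⟩

/-- `μ_M`, the minimum over `j ≠ k` in `{1, …, 8}` (`p = (j, k)`) of
`(1 - t(k)) (u(k) - u(j)) + t(k) (v(k) - v(j))`. -/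
def muM (M : ℝ) : ℝ :=
  (Finset.Icc 1 8 : Finset ℕ).offDiag.inf' offDiag_nonempty fun p =>
    (1 - tk M p.2) * (u M p.2 - u M p.1) + tk M p.2 * (v M p.2 - v M p.1)

/-- `δ_i(k)`: the vector of `ℝ^8` equal to `Δ` at `i` and `0` elsewhere. -/
def dvec (Δ : ℝ) (i k : ℕ) : ℝ := if k = i then Δ else 0

/-- The constraints under which the parameters `δ, M, Δ` are chosen. -/
structure Admissible (δ M Δ : ℝ) : Prop where
  delta_pos : 0 < δ
  delta_lt : δ < 1 / 10
  M_gt : 16 < M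
  M_large : 8 / M + deltaM M + muM M < (1 - 8 * δ) / 6
  deltaM_lt : deltaM M < δ / 3
  Delta_pos : 0 < Δ
  Delta_lt_mu : Δ < muM M / 2
  Delta_lt_delta : Δ < δ / 6
  Delta_lt_sub : Δ < (1 - 2 * δ) / 3 - deltaM M
  Delta_lt_deltaM : Δ < deltaM M
  Delta_lt_half : Δ < (1 - deltaM M) / 2

/-- The number `m ≥ 0` of the block containing `q`, where `q = 8 m + k` with `1 ≤ k ≤ 8`. -/
def block (q : ℕ+) : ℕ := ((q : ℕ) - 1) / 8

/-- The position `k ∈ {1, …, 8}` of `q = 8 m + k` inside its block. -/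
def pos (q : ℕ+) : ℕ := ((q : ℕ) - 1) % 8 + 1

theorem block_pos (q : ℕ+) : 8 * block q + pos q = (q : ℕ) := by
  have := q.pos
  unfold block pos
  omega

theorem pos_mem (q : ℕ+) : pos q ∈ Finset.Icc 1 8 := by
  simp only [Finset.mem_Icc, pos]
  omega

/-- The coordinates of `U_i`, for `i = 1, 2`. On the row `{1} × ℕ` the blocks with number
congruent to `i - 1` modulo `2` carry `u`, the others carry `δ_8`. -/
def fU (e : ℕ → LInf) (M Δ : ℝ) (i : ℕ) (x : ℕ+ × ℕ+) : ℝ :=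
  if x.1 = 1 then
    if (block x.2 + 1) % 2 = i % 2 then u M (pos x.2) else dvec Δ 8 (pos x.2)
  else 1 / 10 * e 1 x.2

/-- The coordinates of `V_{i,n}`, for `i = 1, 2` and `n ≥ 1`. -/
def fV (e : ℕ → LInf) (δ M Δ : ℝ) (i n : ℕ) (x : ℕ+ × ℕ+) : ℝ :=
  if x.1 = 1 then
    if block x.2 = n then
      (-1) ^ (i - 1) * ((1 - δ) / 3 - dvec Δ (i + 1) (pos x.2))
    else if block x.2 = n + 1 then
      v M (pos x.2) - (2 + 2 * δ) / 3 + (-1) ^ i * dvec Δ 7 (pos x.2)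
    else if block x.2 % 2 = n % 2 then
      (-1) ^ (i - 1) * ((1 - 2 * δ) / 3 - dvec Δ 6 (pos x.2))
    else 0
  else if (x.1 : ℕ) = 2 * n + i - 1 then (-1) ^ (i - 1) * ((1 - δ) / 3) * e 1 x.2
  else if (x.1 : ℕ) = 2 * (n + 1) ∨ (x.1 : ℕ) = 2 * (n + 1) + 1 then 0
  else 1 / 10 * e (2 * n + i - 1) x.2

/-! Boundedness of these functions. -/

theorem exists_bound_pos (h : ℕ → ℝ) : ∃ C, ∀ x : ℕ+ × ℕ+, |h (pos x.2)| ≤ C :=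
  ⟨∑ k ∈ Finset.Icc 1 8, |h k|, fun x =>
    Finset.single_le_sum (f := fun k => |h k|) (fun _ _ => abs_nonneg _) (pos_mem x.2)⟩

theorem exists_bound_coord (c : ℝ) (w : LInf) : ∃ C, ∀ x : ℕ+ × ℕ+, |c * w x.2| ≤ C :=
  ⟨|c| * ‖w‖, fun x => by
    rw [abs_mul]
    exact mul_le_mul_of_nonneg_left (lp.norm_apply_le_norm ENNReal.top_ne_zero w x.2)
      (abs_nonneg c)⟩

theorem exists_bound_ite (p : ℕ+ × ℕ+ → Prop) [DecidablePred p] {f g : ℕ+ × ℕ+ → ℝ}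
    (hf : ∃ C, ∀ x, |f x| ≤ C) (hg : ∃ C, ∀ x, |g x| ≤ C) :
    ∃ C, ∀ x, |if p x then f x else g x| ≤ C := by
  obtain ⟨A, hA⟩ := hf
  obtain ⟨B, hB⟩ := hg
  refine ⟨max A B, fun x => ?_⟩
  split_ifs
  · exact (hA x).trans (le_max_left _ _)
  · exact (hB x).trans (le_max_right _ _)

theorem memLInf_of_bound {f : ℕ+ × ℕ+ → ℝ} (h : ∃ C, ∀ x, |f x| ≤ C) : Memℓp f ∞ := by
  obtain ⟨C, hC⟩ := h
  refine memℓp_infty ⟨C, ?_⟩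
  rintro _ ⟨x, rfl⟩
  exact hC x

theorem fU_mem (e : ℕ → LInf) (M Δ : ℝ) (i : ℕ) : Memℓp (fU e M Δ i) ∞ := by
  refine memLInf_of_bound (exists_bound_ite _ (exists_bound_ite _ ?_ ?_) ?_)
  · exact exists_bound_pos (u M)
  · exact exists_bound_pos (dvec Δ 8)
  · exact exists_bound_coord _ _

theorem fV_mem (e : ℕ → LInf) (δ M Δ : ℝ) (i n : ℕ) : Memℓp (fV e δ M Δ i n) ∞ := by
  refine memLInf_of_bound (exists_bound_ite _ (exists_bound_ite _ ?_ (exists_bound_ite _ ?_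
    (exists_bound_ite _ ?_ ?_))) (exists_bound_ite _ ?_ (exists_bound_ite _ ?_ ?_)))
  · exact exists_bound_pos fun k => (-1) ^ (i - 1) * ((1 - δ) / 3 - dvec Δ (i + 1) k)
  · exact exists_bound_pos fun k => v M k - (2 + 2 * δ) / 3 + (-1) ^ i * dvec Δ 7 k
  · exact exists_bound_pos fun k => (-1) ^ (i - 1) * ((1 - 2 * δ) / 3 - dvec Δ 6 k)
  · exact ⟨0, by simp⟩
  · exact exists_bound_coord _ _
  · exact ⟨0, by simp⟩
  · exact exists_bound_coord _ _

/-- `U_i` as an element of `ℓ_∞(ℕ²)`. -/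
def vecU (e : ℕ → LInf) (M Δ : ℝ) (i : ℕ) : LInf2 := ⟨fU e M Δ i, fU_mem e M Δ i⟩

/-- `V_{i,n}` as an element of `ℓ_∞(ℕ²)`. -/
def vecV (e : ℕ → LInf) (δ M Δ : ℝ) (i n : ℕ) : LInf2 := ⟨fV e δ M Δ i n, fV_mem e δ M Δ i n⟩

/-- The spanning vectors `V_{i,n}` (`i = 1, 2`, `n ≥ 1`) and `U_1, U_2`. -/
def generators (e : ℕ → LInf) (δ M Δ : ℝ) : Set LInf2 :=
  {w | ∃ i ∈ ({1, 2} : Set ℕ), ∃ n, 1 ≤ n ∧ w = vecV e δ M Δ i n} ∪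
    {w | ∃ i ∈ ({1, 2} : Set ℕ), w = vecU e M Δ i}

/-- The space `X`, the closed linear span in `ℓ_∞(ℕ²)` of the generators. -/
def X (e : ℕ → LInf) (δ M Δ : ℝ) : Submodule ℝ LInf2 :=
  (Submodule.span ℝ (generators e δ M Δ)).topologicalClosure

/-- `U_i` as an element of `X`. -/
def U (e : ℕ → LInf) (δ M Δ : ℝ) (i : ℕ) (hi : i ∈ ({1, 2} : Set ℕ)) : X e δ M Δ :=
  ⟨vecU e M Δ i, Submodule.le_topologicalClosure _ (Submodule.subset_span (Or.inr ⟨i, hi, rfl⟩))⟩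

/-- `V_{i,n}` as an element of `X`. -/
def V (e : ℕ → LInf) (δ M Δ : ℝ) (i n : ℕ) (hi : i ∈ ({1, 2} : Set ℕ)) (hn : 1 ≤ n) :
    X e δ M Δ :=
  ⟨vecV e δ M Δ i n,
    Submodule.le_topologicalClosure _ (Submodule.subset_span (Or.inl ⟨i, hi, n, hn, rfl⟩))⟩

/-- `R` is a retraction of its domain onto the subset `D`. -/
def IsRetractionOnto {E : Type*} (R : E → E) (D : Set E) : Prop :=
  (∀ x, R x ∈ D) ∧ ∀ x ∈ D, R x = x

end RetractSpace

end

/-!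
The proof is an induction on `n`: if `D` comes `ε₀`-close to all `± U_i` and `± V_{i,n}`, then `R`
moves the points `± V_{i,n+1}` by at most `ε₀`. What has to be avoided is that the errors add up.

Let `x = V_{i,n+1}` and `y = R x`, and let `η = ε₀ / C` be the excess of the Lipschitz constant.
For every `k` from `1` to `8` and every sign `τ`, let `z = τ mix`, where `mix` is the convex
combination `(1 - t(k)) U_j + t(k) (V_{1,n} + V_{2,n}) / 2` with `j` chosen according to the
parity of `n`. The points `(u(k), v(k))` lie on a parabola and `1 - t(k)`, `t(k)` are the weights
of its tangent at the `k`-th of them; therefore `x - z` attains its norm only at the position `k`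
of the block `n + 1` of the first row, and exceeds its other coordinates by a fixed gap
(`vecV_sub_mix_apply_le`). By convexity, `D` contains a point `z'` that is `ε₀`-close to `z`. If
`2 ε₀` is at most the gap, the norm of `x - z'` is attained at the same coordinate, and `‖y - z'‖
≤ (1 + η) ‖x - z'‖` bounds that coordinate of `y - x` on one side by `η ‖x - z'‖`, in which `ε₀`
does not occur (`mul_apply_sub_le`). The two signs `τ` bound it on both sides, so `y - x` is
`O(η)` on the whole block `n + 1`.

This is enough to control `y - x` in norm (`exists_norm_le`). The eight values on the block
determine the coefficients of `U_1`, `U_2`, `V_{j,n}` and `V_{j,n+1}`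
(`exists_abs_le_of_blockValue`). The remaining coefficients are seen by the row `2 (n + 1) + i -
1`: there `x` is a multiple of `e 1` of norm `(1 - δ) / 3 = ‖x‖`, and they are coefficients of `e
2, e 3, …`. Since `‖y‖ ≤ (1 + η) ‖x‖`, because `0 ∈ D`, and since the `e n` span `ℓ_1`, the sum of
their absolute values is `O(η)` (`sum_abs_le_of_row`). Hence `‖y - x‖ ≤ C η = ε₀` with `C`
independent of `n`.
-/

open scoped ENNReal

namespace RetractSpace

/-! ### The scalar parameters -/

theorem xk_lt_xk {M : ℝ} (hM : 16 < M) {j k : ℕ} (hjk : j < k) (hk : k ≤ 8) :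
    xk M j < xk M k := by
  have hM0 : 0 < M := by linarith
  have hj' : (j : ℝ) < k := by exact_mod_cast hjk
  have hk' : (k : ℝ) ≤ 8 := by exact_mod_cast hk
  have h : ∀ l : ℕ, xk M l = (M / 2 + l) / (M - 2 * l) := by
    intro l
    unfold xk
    rw [← mul_div_mul_right (1 / 2 + (l : ℝ) / M) _ hM0.ne']
    congr 1 <;> field_simp
  rw [h, h, div_lt_div_iff₀ (by linarith) (by linarith)]
  nlinarith

theorem xk_le_xk {M : ℝ} (hM : 16 < M) {j k : ℕ} (hjk : j ≤ k) (hk : k ≤ 8) :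
    xk M j ≤ xk M k := by
  rcases hjk.eq_or_lt with rfl | h
  · exact le_rfl
  · exact (xk_lt_xk hM h hk).le

theorem half_lt_xk {M : ℝ} (hM : 16 < M) {k : ℕ} (hk : k ∈ Finset.Icc 1 8) :
    1 / 2 < xk M k := by
  rw [Finset.mem_Icc] at hk
  have h0 : xk M 0 = 1 / 2 := by simp [xk]
  rw [← h0]
  exact xk_lt_xk hM (by omega) hk.2

theorem u_le_one {M : ℝ} (hM : 16 < M) {k : ℕ} (hk : k ∈ Finset.Icc 1 8) : u M k ≤ 1 := by
  rw [Finset.mem_Icc] at hk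
  have := xk_le_xk hM hk.2 le_rfl
  unfold u
  linarith

theorem le_u {M : ℝ} (hM : 16 < M) {k : ℕ} (hk : k ∈ Finset.Icc 1 8) : 1 - deltaM M ≤ u M k := by
  have h1 := half_lt_xk hM (k := 1) (by simp)
  have h8 := half_lt_xk hM (k := 8) (by simp)
  rw [Finset.mem_Icc] at hk
  have h := xk_le_xk hM hk.1 hk.2
  have h' := xk_le_xk hM (hk.1.trans hk.2) le_rfl
  unfold u deltaM
  nlinarith

theorem v_le_one {M : ℝ} (hM : 16 < M) {k : ℕ} (hk : k ∈ Finset.Icc 1 8) : v M k ≤ 1 := by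
  have h1 := half_lt_xk hM (k := 1) (by simp)
  rw [Finset.mem_Icc] at hk
  have h := xk_le_xk hM hk.1 hk.2
  unfold v
  nlinarith

theorem le_v {M : ℝ} (hM : 16 < M) {k : ℕ} (hk : k ∈ Finset.Icc 1 8) : 1 - deltaM M ≤ v M k := by
  have h1 := half_lt_xk hM hk
  rw [Finset.mem_Icc] at hk
  have h := xk_le_xk hM hk.2 le_rfl
  unfold v deltaM
  nlinarith

theorem muM_le (M : ℝ) {j k : ℕ} (hj : j ∈ Finset.Icc 1 8) (hk : k ∈ Finset.Icc 1 8)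
    (hjk : j ≠ k) :
    muM M ≤ (1 - tk M k) * (u M k - u M j) + tk M k * (v M k - v M j) :=
  Finset.inf'_le (fun p : ℕ × ℕ =>
    (1 - tk M p.2) * (u M p.2 - u M p.1) + tk M p.2 * (v M p.2 - v M p.1))
    (Finset.mem_offDiag.2 ⟨hj, hk, hjk⟩ : (j, k) ∈ (Finset.Icc 1 8 : Finset ℕ).offDiag)

theorem dvec_nonneg {Δ : ℝ} (h : 0 < Δ) (i k : ℕ) : 0 ≤ dvec Δ i k := by
  unfold dvec
  split_ifs <;> linarith

theorem dvec_le {Δ : ℝ} (h : 0 < Δ) (i k : ℕ) : dvec Δ i k ≤ Δ := by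
  unfold dvec
  split_ifs <;> linarith

theorem dvec_add_dvec_le {Δ : ℝ} (h : 0 < Δ) {i j : ℕ} (hij : i ≠ j) (k : ℕ) :
    dvec Δ i k + dvec Δ j k ≤ Δ := by
  unfold dvec
  split_ifs <;> first | linarith | omega

/-! ### Coordinates of the generators and of the test points -/

theorem abs_e_apply_le {e : ℕ → LInf} (he : IsEllOneBasis e) {n : ℕ} (hn : 1 ≤ n) (q : ℕ+) :
    |e n q| ≤ 1 := by
  have := lp.norm_apply_le_norm ENNReal.top_ne_zero (e n) q
  rwa [he.1 n hn] at this

/-- The element of `ℕ = {1, 2, …}` at position `k` of the block `m`. -/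
def coord (m k : ℕ) (hk : k ∈ Finset.Icc 1 8) : ℕ+ :=
  ⟨8 * m + k, by rw [Finset.mem_Icc] at hk; omega⟩

theorem block_coord (m k : ℕ) (hk : k ∈ Finset.Icc 1 8) : block (coord m k hk) = m := by
  rw [Finset.mem_Icc] at hk
  simp only [block, coord, PNat.mk_coe]
  omega

theorem pos_coord (m k : ℕ) (hk : k ∈ Finset.Icc 1 8) : pos (coord m k hk) = k := by
  rw [Finset.mem_Icc] at hk
  simp only [pos, coord, PNat.mk_coe]
  omega

theorem eq_coord {q : ℕ+} {m k : ℕ} (hk : k ∈ Finset.Icc 1 8) (h1 : block q = m)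
    (h2 : pos q = k) : q = coord m k hk := by
  apply PNat.coe_injective
  rw [← block_pos q, h1, h2]
  rfl

/-- The index `i ∈ {1, 2}` for which `U_i` carries the values `u` on the block `n + 1`. -/
def parIdx (n : ℕ) : ℕ := 2 - n % 2

theorem parIdx_mem (n : ℕ) : parIdx n ∈ ({1, 2} : Set ℕ) := by
  simp only [parIdx, Set.mem_insert_iff, Set.mem_singleton_iff]
  omega

/-- The convex combination of `U_i`, `V_{1,n}`, `V_{2,n}` (`i` being `parIdx n`) with weights
`1 - t(k)`, `t(k) / 2`, `t(k) / 2`. -/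
noncomputable def mix (e : ℕ → LInf) (δ M Δ : ℝ) (n k : ℕ) : LInf2 :=
  (1 - tk M k) • vecU e M Δ (parIdx n) +
    ((tk M k / 2) • vecV e δ M Δ 1 n + (tk M k / 2) • vecV e δ M Δ 2 n)

section Values

variable (e : ℕ → LInf) (δ M Δ : ℝ)

theorem mix_apply (n k : ℕ) (x : ℕ+ × ℕ+) :
    mix e δ M Δ n k x = (1 - tk M k) * fU e M Δ (parIdx n) x +
      tk M k / 2 * (fV e δ M Δ 1 n x + fV e δ M Δ 2 n x) := by
  have : mix e δ M Δ n k x = (1 - tk M k) * fU e M Δ (parIdx n) x +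
      (tk M k / 2 * fV e δ M Δ 1 n x + tk M k / 2 * fV e δ M Δ 2 n x) := rfl
  rw [this]
  ring

theorem mix_next {n k : ℕ} {q : ℕ+} (h : block q = n + 1) :
    mix e δ M Δ n k (1, q) =
      (1 - tk M k) * u M (pos q) + tk M k * (v M (pos q) - (2 + 2 * δ) / 3) := by
  have h1 : (n + 1 + 1) % 2 = parIdx n % 2 := by unfold parIdx; omega
  rw [mix_apply]
  simp [fU, fV, h, h1]
  ring

theorem mix_same {n k : ℕ} {q : ℕ+} (h : block q % 2 = (n + 1) % 2) (h' : block q ≠ n + 1) :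
    mix e δ M Δ n k (1, q) = (1 - tk M k) * u M (pos q) := by
  have h1 : (block q + 1) % 2 = parIdx n % 2 := by unfold parIdx; omega
  have h2 : block q ≠ n := by omega
  have h3 : ¬ block q % 2 = n % 2 := by omega
  rw [mix_apply]
  simp [fU, fV, h', h1, h2, h3]

theorem mix_other {n k : ℕ} {q : ℕ+} (h : block q % 2 ≠ (n + 1) % 2) (h' : block q ≠ n) :
    mix e δ M Δ n k (1, q) = (1 - tk M k) * dvec Δ 8 (pos q) := by
  have h1 : ¬ (block q + 1) % 2 = parIdx n % 2 := by unfold parIdx; omega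
  have h2 : block q ≠ n + 1 := by omega
  have h3 : block q % 2 = n % 2 := by omega
  rw [mix_apply]
  simp [fU, fV, h', h1, h2, h3]

theorem mix_self {n k : ℕ} {q : ℕ+} (h : block q = n) :
    mix e δ M Δ n k (1, q) =
      (1 - tk M k) * dvec Δ 8 (pos q) + tk M k / 2 * (dvec Δ 3 (pos q) - dvec Δ 2 (pos q)) := by
  have h1 : ¬ (n + 1) % 2 = parIdx n % 2 := by unfold parIdx; omega
  rw [mix_apply]
  simp [fU, fV, h, h1]

end Values

/-! ### The coordinate at which the norm is attained -/

section Gap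

variable {e : ℕ → LInf} {δ M Δ : ℝ}

theorem Admissible.tk_bounds (h : Admissible δ M Δ) {k : ℕ} (hk : k ∈ Finset.Icc 1 8) :
    0 < tk M k ∧ tk M k < 1 / 2 ∧ 1 / 2 - tk M k ≤ 8 / M := by
  have hM := h.M_gt
  have hM0 : 0 < M := by linarith
  rw [Finset.mem_Icc] at hk
  have h1 : (1 : ℝ) ≤ k := by exact_mod_cast hk.1
  have h8 : (k : ℝ) ≤ 8 := by exact_mod_cast hk.2
  have a : 0 < (k : ℝ) / M := by positivity
  have b : (k : ℝ) / M ≤ 8 / M := by gcongr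
  have c : 8 / M < 1 / 2 := by rw [div_lt_iff₀ hM0]; linarith
  unfold tk
  refine ⟨by linarith, by linarith, by linarith⟩

/-- The amount by which the largest coordinate of `V_{i,n+1} ± mix n k` exceeds the others. -/
noncomputable def gap (δ M : ℝ) : ℝ := min (muM M / 2) (δ / 6)

theorem Admissible.gap_pos (h : Admissible δ M Δ) : 0 < gap δ M :=
  lt_min (h.Delta_pos.trans h.Delta_lt_mu) (by linarith [h.delta_pos])

set_option maxHeartbeats 1000000 in
/-- On the first row, the coordinate at the position `k` of the block `n + 1` of `V_{i,n+1} - τ mix`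
dominates all others. The right-hand side is at least `1 / 3 - δ_M`, whatever the sign `τ` is. -/
theorem gap_first_row (h : Admissible δ M Δ) {i n k : ℕ} (hi : i ∈ ({1, 2} : Set ℕ))
    (hk : k ∈ Finset.Icc 1 8) {τ : ℝ} (hτ : τ = 1 ∨ τ = -1) {q : ℕ+}
    (hq : q ≠ coord (n + 1) k hk) :
    |fV e δ M Δ i (n + 1) (1, q) - τ * mix e δ M Δ n k (1, q)| + gap δ M ≤
      mix e δ M Δ n k (1, coord (n + 1) k hk) -
        τ * fV e δ M Δ i (n + 1) (1, coord (n + 1) k hk) := by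
  have hM := h.M_gt
  have hδ := h.delta_pos
  have hδ' := h.delta_lt
  have hMl := h.M_large
  have hδM := h.deltaM_lt
  have hΔ := h.Delta_pos
  have hΔμ := h.Delta_lt_mu
  have hΔδ := h.Delta_lt_delta
  obtain ⟨ht0, ht1, ht2⟩ := h.tk_bounds hk
  have hg1 : gap δ M ≤ muM M / 2 := min_le_left _ _
  have hg2 : gap δ M ≤ δ / 6 := min_le_right _ _
  have hμ0 : 0 < muM M := by linarith
  have hu0 := le_u hM hk
  have hv0 := le_v hM hk
  have hu1' := u_le_one hM (pos_mem q)
  have hu0' := le_u hM (pos_mem q)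
  have hv1' := v_le_one hM (pos_mem q)
  have hv0' := le_v hM (pos_mem q)
  have d := fun i => dvec_nonneg hΔ i (pos q)
  have d' := fun i => dvec_le hΔ i (pos q)
  have c := fun i => dvec_nonneg hΔ i k
  have c' := fun i => dvec_le hΔ i k
  set t := tk M k
  have hf : fV e δ M Δ i (n + 1) (1, coord (n + 1) k hk) =
      (-1) ^ (i - 1) * ((1 - δ) / 3 - dvec Δ (i + 1) k) := by
    simp [fV, block_coord, pos_coord]
  have hf' : mix e δ M Δ n k (1, coord (n + 1) k hk) =
      (1 - t) * u M k + t * (v M k - (2 + 2 * δ) / 3) := by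
    rw [mix_next _ _ _ _ (block_coord _ _ _), pos_coord]
  have ha : 1 - deltaM M ≤ (1 - t) * u M k + t * v M k := by nlinarith
  have hb : (1 - t) * (1 - deltaM M) ≤ (1 - t) * u M (pos q) :=
    mul_le_mul_of_nonneg_left hu0' (by linarith)
  have hb' : (1 - t) * u M (pos q) ≤ (1 - t) * 1 :=
    mul_le_mul_of_nonneg_left hu1' (by linarith)
  have htδ : 0 ≤ t * δ := by positivity
  have htδ' : t * δ ≤ 1 / 2 * δ := by gcongr
  have htM : 0 ≤ t * deltaM M := by nlinarith
  have hs1 : (-1 : ℝ) ^ (1 - 1) = 1 := by norm_num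
  have hs2 : (-1 : ℝ) ^ (2 - 1) = -1 := by norm_num
  rw [hf, hf']
  by_cases h1 : block q = n + 1
  · -- the block `n + 1`: this is where the definition of `μ_M` enters
    have hne : pos q ≠ k := fun h2 => hq (eq_coord hk h1 h2)
    have hμ := muM_le M (pos_mem q) hk hne
    have ha' : 1 - deltaM M ≤ (1 - t) * u M (pos q) + t * v M (pos q) := by nlinarith
    rw [mix_next _ _ _ _ h1]
    simp only [fV, h1, if_true]
    have c2 := c (i + 1)
    have c2' := c' (i + 1)
    have d2 := d (i + 1)
    have d2' := d' (i + 1)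
    rcases hi with rfl | rfl <;> rcases hτ with rfl | rfl <;> simp only [hs1, hs2] <;>
          rw [← le_sub_iff_add_le, abs_le] <;> constructor <;>
          linarith only [hμ, hg1, hg2, ht1, hΔμ, c2, c2', d2, d2', ha, ha', htδ, htδ', hδM, hΔδ,
            hδ', hδ]
  · by_cases h2 : block q % 2 = (n + 1) % 2
    · -- the other blocks of the same parity, where `U_i` is close to `1` and the `V_{j,n}` vanish
      rw [mix_same _ _ _ _ h2 h1]
      have h3 : block q ≠ n + 1 + 1 := by omega
      simp only [fV, h1, h2, h3, if_true, if_false]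
      have c2 := c (i + 1)
      have c2' := c' (i + 1)
      have d6 := d 6
      have d6' := d' 6
      rcases hi with rfl | rfl <;> rcases hτ with rfl | rfl <;> simp only [hs1, hs2] <;>
          rw [← le_sub_iff_add_le, abs_le] <;> constructor <;>
          linarith only [hg2, hΔδ, c2, c2', d6, d6', ha, hb, hb', htδ, htδ', htM, hδM, hδ', hδ,
            hMl, hμ0, ht1, ht2]
    · by_cases h4 : block q = n
      · -- the block `n`, where `V_{1,n}` and `V_{2,n}` cancel up to terms of size `Δ`
        rw [mix_self _ _ _ _ h4]
        have h3 : n ≠ n + 1 + 1 := by omega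
        have h5 : ¬ n % 2 = (n + 1) % 2 := by omega
        simp only [fV, h4, h3, h5, if_true, if_false]
        have h6 : n ≠ n + 1 := by omega
        simp only [h6, if_false]
        have c2 := c (i + 1)
        have c2' := c' (i + 1)
        have e8 : (1 - t) * dvec Δ 8 (pos q) ≤ 1 * Δ := 
          mul_le_mul (by linarith) (d' 8) (d 8) zero_le_one
        have e8' : 0 ≤ (1 - t) * dvec Δ 8 (pos q) := mul_nonneg (by linarith) (d 8)
        have e3 : t / 2 * dvec Δ 3 (pos q) ≤ 1 * Δ := 
          mul_le_mul (by linarith) (d' 3) (d 3) zero_le_one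
        have e3' : 0 ≤ t / 2 * dvec Δ 3 (pos q) := mul_nonneg (by linarith) (d 3)
        have e2 : t / 2 * dvec Δ 2 (pos q) ≤ 1 * Δ := 
          mul_le_mul (by linarith) (d' 2) (d 2) zero_le_one
        have e2' : 0 ≤ t / 2 * dvec Δ 2 (pos q) := mul_nonneg (by linarith) (d 2)
        rcases hi with rfl | rfl <;> rcases hτ with rfl | rfl <;> simp only [hs1, hs2] <;>
          rw [← le_sub_iff_add_le, abs_le] <;> constructor <;>
          linarith only [hg2, hΔδ, c2, c2', e8, e8', e3, e3', e2, e2', ha, htδ, htδ', hδM, hδ', hδ,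
            ht1]
      · -- the block `n + 2` has the closest competitor, at most `(1 - 2 δ) / 3 + Δ`;
        -- on the other blocks `V_{i,n+1}` vanishes
        rw [mix_other _ _ _ _ h2 h4]
        simp only [fV, h1, h2, if_true, if_false]
        have c2 := c (i + 1)
        have c2' := c' (i + 1)
        have d7 := d 7
        have d7' := d' 7
        have e8 : (1 - t) * dvec Δ 8 (pos q) ≤ 1 * dvec Δ 8 (pos q) :=
          mul_le_mul_of_nonneg_right (by linarith) (d 8)
        have e8' : 0 ≤ (1 - t) * dvec Δ 8 (pos q) := mul_nonneg (by linarith) (d 8)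
        have d78 := dvec_add_dvec_le hΔ (show 7 ≠ 8 by norm_num) (pos q)
        split_ifs <;>
        rcases hi with rfl | rfl <;> rcases hτ with rfl | rfl <;>
          simp only [hs1, hs2, neg_one_sq] <;>
          rw [← le_sub_iff_add_le, abs_le] <;> constructor <;>
          linarith only [hg2, hΔδ, c2, c2', d7, d7', e8, e8', d78, hv1', hv0', ha, htδ, htδ', hδM,
            hδ', hδ, ht1]

theorem abs_fV_add_fV_le (he : IsEllOneBasis e) (h : Admissible δ M Δ) {n : ℕ} (hn : 1 ≤ n)
    {p q : ℕ+} (hp : p ≠ 1) :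
    |fV e δ M Δ 1 n (p, q) + fV e δ M Δ 2 n (p, q)| ≤ 13 / 30 := by
  have hδ := h.delta_pos
  have hδ' := h.delta_lt
  have h1 := abs_le.1 (abs_e_apply_le he le_rfl q)
  have h2 := abs_le.1 (abs_e_apply_le he (show 1 ≤ 2 * n + 1 - 1 by omega) q)
  have h3 := abs_le.1 (abs_e_apply_le he (show 1 ≤ 2 * n + 2 - 1 by omega) q)
  have h4 : |(1 - δ) / 3 * e 1 q| ≤ 1 / 3 * 1 := by
    rw [abs_mul, abs_of_pos (by linarith : 0 < (1 - δ) / 3)]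
    exact mul_le_mul (by linarith) (abs_e_apply_le he le_rfl q) (abs_nonneg _) (by norm_num)
  rw [abs_le] at h4
  simp only [fV, hp, if_false]
  rw [abs_le]
  by_cases ha : (p : ℕ) = 2 * n + 1 - 1
  · have hb : ¬ (p : ℕ) = 2 * n + 2 - 1 := by omega
    have hc : ¬ ((p : ℕ) = 2 * (n + 1) ∨ (p : ℕ) = 2 * (n + 1) + 1) := by omega
    rw [if_pos ha, if_neg hb, if_neg hc, Nat.sub_self, pow_zero]
    constructor <;> linarith
  · by_cases hb : (p : ℕ) = 2 * n + 2 - 1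
    · have hc : ¬ ((p : ℕ) = 2 * (n + 1) ∨ (p : ℕ) = 2 * (n + 1) + 1) := by omega
      rw [if_neg ha, if_neg hc, if_pos hb, show 2 - 1 = 1 from rfl, pow_one]
      constructor <;> linarith
    · simp only [ha, hb, if_false]
      split_ifs <;> constructor <;> linarith

/-- All rows but the first stay below the dominating coordinate: `V_{i,n+1}` is at most `1 / 10`
there, except on a row where the `V_{j,n}` vanish. -/
theorem gap_other_rows (he : IsEllOneBasis e) (h : Admissible δ M Δ) {i n k : ℕ}
    (hi : i ∈ ({1, 2} : Set ℕ)) (hn : 1 ≤ n)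
    (hk : k ∈ Finset.Icc 1 8) {τ : ℝ} (hτ : τ = 1 ∨ τ = -1) {p q : ℕ+} (hp : p ≠ 1) :
    |fV e δ M Δ i (n + 1) (p, q) - τ * mix e δ M Δ n k (p, q)| + gap δ M ≤
      mix e δ M Δ n k (1, coord (n + 1) k hk) -
        τ * fV e δ M Δ i (n + 1) (1, coord (n + 1) k hk) := by
  have hM := h.M_gt
  have hδ := h.delta_pos
  have hδ' := h.delta_lt
  have hδM := h.deltaM_lt
  have hΔ := h.Delta_pos
  have hΔδ := h.Delta_lt_delta
  obtain ⟨ht0, ht1, ht2⟩ := h.tk_bounds hk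
  have hg2 : gap δ M ≤ δ / 6 := min_le_right _ _
  have hu0 := le_u hM hk
  have hv0 := le_v hM hk
  have c := dvec_nonneg hΔ (i + 1) k
  have c' := dvec_le hΔ (i + 1) k
  have hsum := abs_fV_add_fV_le he h hn (q := q) hp
  have hf : fV e δ M Δ i (n + 1) (1, coord (n + 1) k hk) =
      (-1) ^ (i - 1) * ((1 - δ) / 3 - dvec Δ (i + 1) k) := by
    simp [fV, block_coord, pos_coord]
  have hf' := mix_next e δ M Δ (k := k) (block_coord (n + 1) k hk)
  rw [pos_coord] at hf'
  rw [hf, hf', mix_apply]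
  have hU : fU e M Δ (parIdx n) (p, q) = 1 / 10 * e 1 q := by simp [fU, hp]
  rw [hU]
  set t := tk M k
  have ha : 1 - deltaM M ≤ (1 - t) * u M k + t * v M k := by nlinarith
  have htδ : 0 ≤ t * δ := by positivity
  have htδ' : t * δ ≤ 1 / 2 * δ := by gcongr
  have hs1 : (-1 : ℝ) ^ (1 - 1) = 1 := by norm_num
  have hs2 : (-1 : ℝ) ^ (2 - 1) = -1 := by norm_num
  by_cases hpi : (p : ℕ) = 2 * (n + 1) + i - 1
  · -- the row on which `V_{i,n+1}` is a multiple of `e₁`; there `V_{1,n}` and `V_{2,n}` vanish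
    have h0 : ∀ j ∈ ({1, 2} : Set ℕ), fV e δ M Δ j n (p, q) = 0 := by
      intro j hj
      have h2 : ¬ (p : ℕ) = 2 * n + j - 1 := by
        rcases hi with rfl | rfl <;> rcases hj with rfl | rfl <;> omega
      have h3 : (p : ℕ) = 2 * (n + 1) ∨ (p : ℕ) = 2 * (n + 1) + 1 := by
        rcases hi with rfl | rfl <;> omega
      rw [fV, if_neg hp, if_neg h2, if_pos h3]
    have hV : fV e δ M Δ i (n + 1) (p, q) = (-1) ^ (i - 1) * ((1 - δ) / 3) * e 1 q := by
      rw [fV, if_neg hp, if_pos hpi]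
    rw [h0 1 (by simp), h0 2 (by simp), hV]
    have hone := abs_e_apply_le he le_rfl q
    have e1 : |((1 - δ) / 3 - (1 - t) / 10) * e 1 q| ≤ ((1 - δ) / 3 - (1 - t) / 10) * 1 := by
      rw [abs_mul, abs_of_nonneg (by linarith)]
      exact mul_le_mul_of_nonneg_left hone (by linarith)
    have e2 : |((1 - δ) / 3 + (1 - t) / 10) * e 1 q| ≤ ((1 - δ) / 3 + (1 - t) / 10) * 1 := by
      rw [abs_mul, abs_of_nonneg (by linarith)]
      exact mul_le_mul_of_nonneg_left hone (by linarith)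
    rw [abs_le] at e1 e2
    obtain ⟨e1l, e1r⟩ := e1
    obtain ⟨e2l, e2r⟩ := e2
    rcases hi with rfl | rfl <;> rcases hτ with rfl | rfl <;> simp only [hs1, hs2] <;>
      rw [← le_sub_iff_add_le, abs_le] <;> constructor <;> linarith
  · have hV : |fV e δ M Δ i (n + 1) (p, q)| ≤ 1 / 10 := by
      rw [fV, if_neg hp, if_neg hpi]
      split_ifs
      · norm_num
      · have := abs_e_apply_le he (show 1 ≤ 2 * (n + 1) + i - 1 by omega) q
        rw [abs_mul, abs_of_pos (by norm_num)]
        linarith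
    have e1 : |(1 - t) * (1 / 10 * e 1 q)| ≤ (1 - t) * (1 / 10) := by
      have := abs_e_apply_le he le_rfl q
      rw [abs_mul, abs_mul, abs_of_pos (by linarith : 0 < 1 - t),
        abs_of_pos (by norm_num : (0 : ℝ) < 1 / 10)]
      exact mul_le_mul_of_nonneg_left (by linarith) (by linarith)
    have e2 : |t / 2 * (fV e δ M Δ 1 n (p, q) + fV e δ M Δ 2 n (p, q))| ≤ t / 2 * (13 / 30) := by
      rw [abs_mul, abs_of_pos (by linarith : 0 < t / 2)]
      exact mul_le_mul_of_nonneg_left hsum (by linarith)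
    rw [abs_le] at hV e1 e2
    obtain ⟨hVl, hVr⟩ := hV
    obtain ⟨e1l, e1r⟩ := e1
    obtain ⟨e2l, e2r⟩ := e2
    rcases hi with rfl | rfl <;> rcases hτ with rfl | rfl <;> simp only [hs1, hs2] <;>
      rw [← le_sub_iff_add_le, abs_le] <;> constructor <;> linarith

/-- Up to sign, `V_{i,n+1} - τ • mix n k` attains its norm only at the position `k` of the block
`n + 1` of the first row. -/
theorem vecV_sub_mix_apply_le (he : IsEllOneBasis e) (h : Admissible δ M Δ) {i n k : ℕ}
    (hi : i ∈ ({1, 2} : Set ℕ)) (hn : 1 ≤ n)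
    (hk : k ∈ Finset.Icc 1 8) {τ : ℝ} (hτ : τ = 1 ∨ τ = -1) {c : ℕ+ × ℕ+}
    (hc : c ≠ (1, coord (n + 1) k hk)) :
    |vecV e δ M Δ i (n + 1) c - (τ • mix e δ M Δ n k) c| + gap δ M ≤
      -τ * (vecV e δ M Δ i (n + 1) (1, coord (n + 1) k hk) -
        (τ • mix e δ M Δ n k) (1, coord (n + 1) k hk)) := by
  have hτ2 : τ * τ = 1 := by rcases hτ with rfl | rfl <;> norm_num
  obtain ⟨p, q⟩ := c
  have key : |fV e δ M Δ i (n + 1) (p, q) - τ * mix e δ M Δ n k (p, q)| + gap δ M ≤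
      mix e δ M Δ n k (1, coord (n + 1) k hk) -
        τ * fV e δ M Δ i (n + 1) (1, coord (n + 1) k hk) := by
    by_cases hp : p = 1
    · subst hp
      exact gap_first_row h hi hk hτ fun hq => hc (by rw [hq])
    · exact gap_other_rows he h hi hn hk hτ hp
  refine key.trans (le_of_eq ?_)
  change _ = -τ * (fV e δ M Δ i (n + 1) (1, coord (n + 1) k hk) -
    τ * mix e δ M Δ n k (1, coord (n + 1) k hk))
  linear_combination (-mix e δ M Δ n k (1, coord (n + 1) k hk)) * hτ2

theorem norm_vecU_le (he : IsEllOneBasis e) (h : Admissible δ M Δ) (i : ℕ) :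
    ‖vecU e M Δ i‖ ≤ 1 := by
  refine lp.norm_le_of_forall_le zero_le_one fun ⟨p, q⟩ => ?_
  change |fU e M Δ i (p, q)| ≤ 1
  have h1 := u_le_one h.M_gt (pos_mem q)
  have h2 := le_u h.M_gt (pos_mem q)
  have h3 := dvec_nonneg h.Delta_pos 8 (pos q)
  have h4 := dvec_le h.Delta_pos 8 (pos q)
  have h5 := abs_le.1 (abs_e_apply_le he le_rfl q)
  have hδM := h.deltaM_lt
  have hδ' := h.delta_lt
  have hΔδ := h.Delta_lt_delta
  simp only [fU]
  split_ifs <;> rw [abs_le] <;> constructor <;> linarith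

theorem norm_vecV_le (he : IsEllOneBasis e) (h : Admissible δ M Δ) {i n : ℕ}
    (hi : i ∈ ({1, 2} : Set ℕ)) (hn : 1 ≤ n) : ‖vecV e δ M Δ i n‖ ≤ (1 - δ) / 3 := by
  have hδ := h.delta_pos
  have hδM := h.deltaM_lt
  have hδ' := h.delta_lt
  have hΔ := h.Delta_pos
  have hΔδ := h.Delta_lt_delta
  refine lp.norm_le_of_forall_le (by linarith) fun ⟨p, q⟩ => ?_
  change |fV e δ M Δ i n (p, q)| ≤ _
  have h1 := v_le_one h.M_gt (pos_mem q)
  have h2 := le_v h.M_gt (pos_mem q)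
  have h3 := dvec_nonneg hΔ (i + 1) (pos q)
  have h4 := dvec_le hΔ (i + 1) (pos q)
  have h6 := dvec_nonneg hΔ 6 (pos q)
  have h6' := dvec_le hΔ 6 (pos q)
  have h7 := dvec_nonneg hΔ 7 (pos q)
  have h7' := dvec_le hΔ 7 (pos q)
  have h5 := abs_le.1 (abs_e_apply_le he (show 1 ≤ 2 * n + i - 1 by omega) q)
  have h8 : |(1 - δ) / 3 * e 1 q| ≤ (1 - δ) / 3 * 1 := by
    rw [abs_mul, abs_of_pos (by linarith : 0 < (1 - δ) / 3)]
    exact mul_le_mul_of_nonneg_left (abs_e_apply_le he le_rfl q) (by linarith)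
  rw [abs_le] at h8
  obtain ⟨h8l, h8r⟩ := h8
  have hs1 : (-1 : ℝ) ^ (1 - 1) = 1 := by norm_num
  have hs2 : (-1 : ℝ) ^ (2 - 1) = -1 := by norm_num
  rw [fV, abs_le]
  rcases hi with rfl | rfl <;> simp only [hs1, hs2, neg_one_sq] <;> split_ifs <;> constructor <;>
    linarith

end Gap

/-! ### The values on a block determine the coefficients -/

/-- The values on one block `{8 m + k : 1 ≤ k ≤ 8}` of the first row of a linear combination of the
generators: `c 0` and `c 1` are the coefficients of the two `U_i`, `c 2` and `c 3` those of the
`V_{i,m-1}`, `c 4` and `c 5` those of the `V_{i,m}`, and `c 6` is the alternating sum of the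
coefficients of the other `V_{i,l}` with `l ≡ m` modulo `2`. -/
noncomputable def blockValue (δ M Δ : ℝ) (c : Fin 7 → ℝ) (k : ℕ) : ℝ :=
  c 0 * u M k + c 1 * dvec Δ 8 k + c 2 * (v M k - (2 + 2 * δ) / 3 - dvec Δ 7 k) +
    c 3 * (v M k - (2 + 2 * δ) / 3 + dvec Δ 7 k) + c 4 * ((1 - δ) / 3 - dvec Δ 2 k) -
    c 5 * ((1 - δ) / 3 - dvec Δ 3 k) + c 6 * ((1 - 2 * δ) / 3 - dvec Δ 6 k)

/-- The eight values on a block determine the seven coefficients: the positions `1`, `4`, `5` give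
the coefficients of `1`, `x_k` and `x_k ^ 2`, and then each of the positions `2`, `3`, `6`, `7`, `8`
gives one more. -/
theorem blockValue_injective {δ M Δ : ℝ} (h : Admissible δ M Δ) {c : Fin 7 → ℝ}
    (hc : ∀ k ∈ Finset.Icc 1 8, blockValue δ M Δ c k = 0) : c = 0 := by
  have hΔ := h.Delta_pos.ne'
  have h1 := hc 1 (by simp)
  have h2 := hc 2 (by simp)
  have h3 := hc 3 (by simp)
  have h4 := hc 4 (by simp)
  have h5 := hc 5 (by simp)
  have h6 := hc 6 (by simp)
  have h7 := hc 7 (by simp)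
  have h8 := hc 8 (by simp)
  have x14 := xk_lt_xk h.M_gt (show 1 < 4 by norm_num) (by norm_num)
  have x45 := xk_lt_xk h.M_gt (show 4 < 5 by norm_num) (by norm_num)
  simp only [blockValue, dvec, u, v] at h1 h2 h3 h4 h5 h6 h7 h8
  norm_num at h1 h2 h3 h4 h5 h6 h7 h8
  have e1 : (xk M 4 - xk M 1) * (c 0 - (c 2 + c 3) * (xk M 4 + xk M 1)) = 0 := by
    linear_combination h4 - h1
  have e2 : (xk M 5 - xk M 4) * (c 0 - (c 2 + c 3) * (xk M 5 + xk M 4)) = 0 := by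
    linear_combination h5 - h4
  have e1' := (mul_eq_zero.1 e1).resolve_left (by linarith)
  have e2' := (mul_eq_zero.1 e2).resolve_left (by linarith)
  have e3 : (xk M 5 - xk M 1) * (c 2 + c 3) = 0 := by linear_combination e1' - e2'
  have e3' := (mul_eq_zero.1 e3).resolve_left (by linarith)
  have c0 : c 0 = 0 := by linear_combination e1' + (xk M 4 + xk M 1) * e3'
  have z : ∀ {a : ℝ}, a * Δ = 0 → a = 0 := fun ha => (mul_eq_zero.1 ha).resolve_right hΔ
  have c4 : c 4 = 0 := z (by
    linear_combination h1 - h2 + (xk M 2 - xk M 1) * c0 + (xk M 1 ^ 2 - xk M 2 ^ 2) * e3')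
  have c5 : c 5 = 0 := z (by
    linear_combination h3 - h1 - (xk M 3 - xk M 1) * c0 - (xk M 1 ^ 2 - xk M 3 ^ 2) * e3')
  have c6 : c 6 = 0 := z (by
    linear_combination h1 - h6 + (xk M 6 - xk M 1) * c0 + (xk M 1 ^ 2 - xk M 6 ^ 2) * e3')
  have c1 : c 1 = 0 := z (by
    linear_combination h8 - h1 - (xk M 8 - xk M 1) * c0 - (xk M 1 ^ 2 - xk M 8 ^ 2) * e3')
  have c32 : c 3 - c 2 = 0 := z (by
    linear_combination h7 - h1 - (xk M 7 - xk M 1) * c0 - (xk M 1 ^ 2 - xk M 7 ^ 2) * e3')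
  funext j
  fin_cases j
  · exact c0
  · exact c1
  · change c 2 = 0
    linarith
  · change c 3 = 0
    linarith
  · exact c4
  · exact c5
  · exact c6

theorem exists_abs_le_of_blockValue {δ M Δ : ℝ} (h : Admissible δ M Δ) :
    ∃ K : ℝ, 0 < K ∧ ∀ (c : Fin 7 → ℝ) (η : ℝ), 0 ≤ η →
      (∀ k ∈ Finset.Icc 1 8, |blockValue δ M Δ c k| ≤ η) → ∀ j, |c j| ≤ K * η := by
  let L : (Fin 7 → ℝ) →ₗ[ℝ] (Fin 8 → ℝ) :=
    { toFun := fun c k => blockValue δ M Δ c (k + 1)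
      map_add' := by
        intro a b
        funext k
        simp only [blockValue, Pi.add_apply]
        ring
      map_smul' := by
        intro a b
        funext k
        simp only [blockValue, Pi.smul_apply, smul_eq_mul, RingHom.id_apply]
        ring }
  have hker : L.ker = ⊥ := by
    rw [LinearMap.ker_eq_bot']
    intro c hc
    refine blockValue_injective h fun k hk => ?_
    rw [Finset.mem_Icc] at hk
    have := congrFun hc ⟨k - 1, by omega⟩
    simp only [L, LinearMap.coe_mk, AddHom.coe_mk, Pi.zero_apply] at this
    rwa [Nat.sub_add_cancel hk.1] at this
  obtain ⟨K, hK, hL⟩ := L.exists_antilipschitzWith hker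
  refine ⟨K, hK, fun c η hη hc j => ?_⟩
  have h1 := hL.le_mul_norm (map_zero L) c
  have h2 : ‖L c‖ ≤ η := by
    refine (pi_norm_le_iff_of_nonneg hη).2 fun k => hc _ ?_
    rw [Finset.mem_Icc]
    omega
  calc |c j| ≤ ‖c‖ := norm_le_pi_norm c j
    _ ≤ K * ‖L c‖ := h1
    _ ≤ K * η := by gcongr

/-! ### Linear combinations of the generators -/

/-- The generators as one sequence: `gen 0`, `gen 1` are `U_1`, `U_2`, and `gen (2 n + i - 1)` is
`V_{i,n}`. The indices from `2` on are those of the vectors `e_l` in the definition of `V_{i,n}`. -/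
noncomputable def gen (e : ℕ → LInf) (δ M Δ : ℝ) (l : ℕ) : LInf2 :=
  if l < 2 then vecU e M Δ (l + 1) else vecV e δ M Δ (l % 2 + 1) (l / 2)

variable {e : ℕ → LInf} {δ M Δ : ℝ}

theorem norm_gen_le (he : IsEllOneBasis e) (h : Admissible δ M Δ) (l : ℕ) :
    ‖gen e δ M Δ l‖ ≤ 1 := by
  unfold gen
  split_ifs with hl
  · exact norm_vecU_le he h _
  · refine (norm_vecV_le he h ?_ (by omega)).trans (by linarith [h.delta_pos])
    simp only [Set.mem_insert_iff, Set.mem_singleton_iff]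
    omega

theorem generators_subset_range_gen : generators e δ M Δ ⊆ Set.range (gen e δ M Δ) := by
  rintro w (⟨i, hi, n, hn, rfl⟩ | ⟨i, hi, rfl⟩)
  · refine ⟨2 * n + i - 1, ?_⟩
    have h1 : ¬ 2 * n + i - 1 < 2 := by rcases hi with rfl | rfl <;> omega
    have h2 : (2 * n + i - 1) % 2 + 1 = i := by rcases hi with rfl | rfl <;> omega
    have h3 : (2 * n + i - 1) / 2 = n := by rcases hi with rfl | rfl <;> omega
    rw [gen, if_neg h1, h2, h3]
  · refine ⟨i - 1, ?_⟩
    have h1 : i - 1 < 2 := by rcases hi with rfl | rfl <;> omega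
    have h2 : i - 1 + 1 = i := by rcases hi with rfl | rfl <;> omega
    rw [gen, if_pos h1, h2]

/-- Elements of `X` are approximated by finite linear combinations of the generators, which may be
taken arbitrarily long. -/
theorem exists_sum_gen_of_mem_X {w : LInf2} (hw : w ∈ X e δ M Δ) {η : ℝ} (hη : 0 < η) (N₀ : ℕ) :
    ∃ (c : ℕ → ℝ) (N : ℕ), N₀ ≤ N ∧
      ‖w - ∑ l ∈ Finset.range (N + 1), c l • gen e δ M Δ l‖ ≤ η := by
  have hw' : w ∈ closure (Submodule.span ℝ (generators e δ M Δ) : Set LInf2) := hw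
  obtain ⟨w', hw', hd⟩ := Metric.mem_closure_iff.1 hw' η hη
  have hw'' := Submodule.span_mono generators_subset_range_gen hw'
  obtain ⟨c, rfl⟩ := Finsupp.mem_span_range_iff_exists_finsupp.1 hw''
  refine ⟨c, N₀ + c.support.sup id, by omega, ?_⟩
  have hs : c.support ⊆ Finset.range (N₀ + c.support.sup id + 1) := by
    intro l hl
    have := Finset.le_sup (f := id) hl
    simp only [id, Finset.mem_range] at this ⊢
    omega
  rw [Finsupp.sum_of_support_subset c hs _ (by simp), dist_eq_norm] at hd
  exact hd.le

theorem sum_gen_apply (c : ℕ → ℝ) (s : Finset ℕ) (x : ℕ+ × ℕ+) :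
    (∑ l ∈ s, c l • gen e δ M Δ l : LInf2) x = ∑ l ∈ s, c l * gen e δ M Δ l x := by
  rw [lp.coeFn_sum, Finset.sum_apply]
  rfl

/-- The sign with which `gen l` contributes to `c 6` in `blockValue` on the block `n + 1`. -/
def altSign (n l : ℕ) : ℝ :=
  if 2 ≤ l ∧ l / 2 ≠ n + 1 ∧ (l / 2) % 2 = (n + 1) % 2 then (-1) ^ (l % 2) else 0

theorem gen_block (n l : ℕ) (hn : 1 ≤ n) {k : ℕ} (hk : k ∈ Finset.Icc 1 8) :
    gen e δ M Δ l (1, coord (n + 1) k hk) =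
      (if l = parIdx n - 1 then u M k else 0) + (if l = 2 - parIdx n then dvec Δ 8 k else 0) +
      (if l = 2 * n then v M k - (2 + 2 * δ) / 3 - dvec Δ 7 k else 0) +
      (if l = 2 * n + 1 then v M k - (2 + 2 * δ) / 3 + dvec Δ 7 k else 0) +
      (if l = 2 * n + 2 then (1 - δ) / 3 - dvec Δ 2 k else 0) -
      (if l = 2 * n + 3 then (1 - δ) / 3 - dvec Δ 3 k else 0) +
      altSign n l * ((1 - 2 * δ) / 3 - dvec Δ 6 k) := by
  have hb := block_coord (n + 1) k hk
  have hp := pos_coord (n + 1) k hk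
  by_cases hl : l < 2
  · have h1 : l ≠ 2 * n ∧ l ≠ 2 * n + 1 ∧ l ≠ 2 * n + 2 ∧ l ≠ 2 * n + 3 := by omega
    have h2 : altSign n l = 0 := if_neg (by omega)
    have hf : gen e δ M Δ l (1, coord (n + 1) k hk) = fU e M Δ (l + 1) (1, coord (n + 1) k hk) := by
      rw [gen, if_pos hl]
      rfl
    rw [hf, h2, fU, if_pos rfl, hb, hp]
    simp only [h1, if_false]
    by_cases h3 : (n + 1 + 1) % 2 = (l + 1) % 2
    · rw [if_pos h3, if_pos (by unfold parIdx; omega), if_neg (by unfold parIdx; omega)]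
      ring
    · rw [if_neg h3, if_neg (by unfold parIdx; omega), if_pos (by unfold parIdx; omega)]
      ring
  · have hp2 : l ≠ parIdx n - 1 ∧ l ≠ 2 - parIdx n := by unfold parIdx; omega
    have hf : gen e δ M Δ l (1, coord (n + 1) k hk) =
        fV e δ M Δ (l % 2 + 1) (l / 2) (1, coord (n + 1) k hk) := by
      rw [gen, if_neg hl]
      rfl
    rw [hf, fV, if_pos rfl, hb, hp]
    simp only [hp2, if_false, Nat.add_sub_cancel]
    by_cases h4 : l / 2 = n + 1
    · have h2 : altSign n l = 0 := if_neg (by omega)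
      have h1 : l ≠ 2 * n ∧ l ≠ 2 * n + 1 := by omega
      rw [if_pos h4.symm, h2]
      simp only [h1, if_false]
      rcases (show l = 2 * n + 2 ∨ l = 2 * n + 3 by omega) with h5 | h5
      · rw [if_pos h5, if_neg (by omega), show l % 2 = 0 by omega]
        ring
      · rw [if_pos h5, if_neg (by omega), show l % 2 = 1 by omega]
        ring
    · have h1 : l ≠ 2 * n + 2 ∧ l ≠ 2 * n + 3 := by omega
      rw [if_neg (Ne.symm h4)]
      simp only [h1, if_false]
      by_cases h5 : l / 2 = n
      · have h2 : altSign n l = 0 := if_neg (by omega)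
        rw [if_pos (by omega), h2]
        rcases (show l = 2 * n ∨ l = 2 * n + 1 by omega) with h6 | h6
        · rw [if_pos h6, if_neg (by omega), show l % 2 = 0 by omega]
          ring
        · rw [if_pos h6, if_neg (by omega), show l % 2 = 1 by omega]
          ring
      · rw [if_neg (by omega : ¬ n + 1 = l / 2 + 1), if_neg (by omega : ¬ l = 2 * n),
          if_neg (by omega : ¬ l = 2 * n + 1)]
        by_cases h6 : (n + 1) % 2 = l / 2 % 2
        · rw [if_pos h6, altSign, if_pos (by omega)]
          ring
        · rw [if_neg h6, altSign, if_neg (by omega)]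
          ring

theorem sum_gen_block {n N : ℕ} (hn : 1 ≤ n) (hN : 2 * n + 3 ≤ N) (c : ℕ → ℝ) {k : ℕ}
    (hk : k ∈ Finset.Icc 1 8) :
    (∑ l ∈ Finset.range (N + 1), c l • gen e δ M Δ l : LInf2) (1, coord (n + 1) k hk) =
      blockValue δ M Δ ![c (parIdx n - 1), c (2 - parIdx n), c (2 * n), c (2 * n + 1),
        c (2 * n + 2), c (2 * n + 3), ∑ l ∈ Finset.range (N + 1), c l * altSign n l] k := by
  have hp : parIdx n ≤ 2 := by unfold parIdx; omega
  rw [sum_gen_apply, Finset.sum_congr rfl fun l _ => by rw [gen_block n l hn hk]]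
  simp only [mul_add, mul_sub, mul_ite, mul_zero, Finset.sum_add_distrib, Finset.sum_sub_distrib,
    Finset.sum_ite_eq']
  rw [if_pos (by rw [Finset.mem_range]; omega), if_pos (by rw [Finset.mem_range]; omega),
    if_pos (by rw [Finset.mem_range]; omega), if_pos (by rw [Finset.mem_range]; omega),
    if_pos (by rw [Finset.mem_range]; omega), if_pos (by rw [Finset.mem_range]; omega)]
  simp only [← mul_assoc, ← Finset.sum_mul]
  simp only [blockValue, Matrix.cons_val]
  ring

/-- On the row `2 (n + 1) + i - 1`, the vector `V_{i,n+1}` and the `U_j` are multiples of `e 1`, the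
`V_{j,n}` vanish and every other generator `gen l` is `1 / 10 * e l`. -/
theorem gen_row {n i : ℕ} (hi : i ∈ ({1, 2} : Set ℕ)) {p : ℕ+}
    (hp : (p : ℕ) = 2 * (n + 1) + i - 1) (l : ℕ) (q : ℕ+) :
    gen e δ M Δ l (p, q) =
      (if l = 0 then 1 / 10 * e 1 q else 0) + (if l = 1 then 1 / 10 * e 1 q else 0) +
      (if l = 2 * (n + 1) + i - 1 then (-1) ^ (i - 1) * ((1 - δ) / 3) * e 1 q else 0) +
      (if l < 2 ∨ l = 2 * n ∨ l = 2 * n + 1 ∨ l = 2 * (n + 1) + i - 1 then 0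
        else 1 / 10 * e l q) := by
  have hp1 : p ≠ 1 := by
    rintro rfl
    rw [PNat.one_coe] at hp
    rcases hi with rfl | rfl <;> omega
  have hi' : i = 1 ∨ i = 2 := hi
  by_cases hl : l < 2
  · have hf : gen e δ M Δ l (p, q) = fU e M Δ (l + 1) (p, q) := by
      rw [gen, if_pos hl]
      rfl
    rw [hf, fU, if_neg hp1, if_neg (by omega : ¬ l = 2 * (n + 1) + i - 1), if_pos (Or.inl hl)]
    rcases (show l = 0 ∨ l = 1 by omega) with rfl | rfl <;> simp
  · have hf : gen e δ M Δ l (p, q) = fV e δ M Δ (l % 2 + 1) (l / 2) (p, q) := by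
      rw [gen, if_neg hl]
      rfl
    rw [hf, fV, if_neg hp1, if_neg (by omega : ¬ l = 0), if_neg (by omega : ¬ l = 1), hp,
      show 2 * (l / 2) + (l % 2 + 1) - 1 = l by omega, Nat.add_sub_cancel]
    by_cases h1 : l = 2 * (n + 1) + i - 1
    · rw [if_pos h1.symm, if_pos h1, if_pos (by omega), show l % 2 = i - 1 by omega]
      ring
    · rw [if_neg (Ne.symm h1), if_neg h1]
      by_cases h2 : l / 2 = n
      · rw [if_pos (by omega), if_pos (by omega)]
        ring
      · rw [if_neg (by omega), if_neg (by omega)]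
        ring

/-- If the row `2 (n + 1) + i - 1` of `V_{i,n+1} + w` is not much larger than that of `V_{i,n+1}`,
then the coefficients of `w` are controlled by the few of them that do not appear on that row as
coefficients of `e 2, e 3, …`. -/
theorem sum_abs_le_of_row (he : IsEllOneBasis e) (h : Admissible δ M Δ) {n i N : ℕ}
    (hi : i ∈ ({1, 2} : Set ℕ)) (hn : 1 ≤ n) (hN : 2 * n + 3 ≤ N) (c : ℕ → ℝ) {p : ℕ+}
    (hp : (p : ℕ) = 2 * (n + 1) + i - 1) {η : ℝ}
    (hrow : ∀ q, |(vecV e δ M Δ i (n + 1) +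
      ∑ l ∈ Finset.range (N + 1), c l • gen e δ M Δ l : LInf2) (p, q)| ≤ (1 - δ) / 3 + η) :
    ∑ l ∈ Finset.range (N + 1), |c l| ≤
      10 * η + 5 * (|c 0| + |c 1| + |c (2 * n)| + |c (2 * n + 1)| + |c (2 * (n + 1) + i - 1)|) := by
  have hi' : i = 1 ∨ i = 2 := hi
  have hδ := h.delta_pos
  have hδ' := h.delta_lt
  obtain ⟨L, hL⟩ : ∃ L, L = 2 * (n + 1) + i - 1 := ⟨_, rfl⟩
  set θ : ℝ := (-1) ^ (i - 1) * ((1 - δ) / 3) * (1 + c L) + 1 / 10 * (c 0 + c 1) with hθ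
  -- the coefficients of `V_{i,n+1} + w` on the row, with respect to `e 1, e 2, …`
  set a : ℕ → ℝ := fun l => if l = 1 then θ else
    if l < 2 ∨ l = 2 * n ∨ l = 2 * n + 1 ∨ l = L then 0 else 1 / 10 * c l with ha
  have hcoord : ∀ q, (vecV e δ M Δ i (n + 1) +
      ∑ l ∈ Finset.range (N + 1), c l • gen e δ M Δ l : LInf2) (p, q) =
      (∑ l ∈ Finset.Icc 1 N, a l • e l : LInf) q := by
    intro q
    have hV : fV e δ M Δ i (n + 1) (p, q) = (-1) ^ (i - 1) * ((1 - δ) / 3) * e 1 q := by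
      have hp1 : p ≠ 1 := by
        rintro rfl
        rw [PNat.one_coe] at hp
        omega
      rw [fV, if_neg hp1, if_pos hp]
    have hr : ∀ f : ℕ → ℝ, ∑ l ∈ Finset.range (N + 1), f l = f 0 + ∑ l ∈ Finset.Icc 1 N, f l := by
      intro f
      rw [Finset.sum_range_succ', add_comm, Finset.range_eq_Ico, Finset.sum_Ico_add' f 0 N 1]
      congr 1
    have h1 : (∑ l ∈ Finset.Icc 1 N, a l • e l : LInf) q = ∑ l ∈ Finset.Icc 1 N, a l * e l q := by
      rw [lp.coeFn_sum, Finset.sum_apply]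
      rfl
    have h2 : (vecV e δ M Δ i (n + 1) +
        ∑ l ∈ Finset.range (N + 1), c l • gen e δ M Δ l : LInf2) (p, q) =
        fV e δ M Δ i (n + 1) (p, q) + ∑ l ∈ Finset.range (N + 1), c l * gen e δ M Δ l (p, q) := by
      rw [← sum_gen_apply]
      rfl
    have h3 : ∀ l ∈ Finset.Icc 1 N, c l * gen e δ M Δ l (p, q) =
        a l * e l q + (if l = 1 then c 1 * (1 / 10 * e 1 q) - θ * e 1 q else 0) +
          (if l = L then c L * ((-1) ^ (i - 1) * ((1 - δ) / 3) * e 1 q) else 0) := by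
      intro l hl
      rw [Finset.mem_Icc] at hl
      rw [gen_row hi hp, ← hL, if_neg (by omega)]
      simp only [ha]
      by_cases h4 : l = 1
      · subst h4
        have h5 : ¬ 1 = L := by omega
        simp only [h5, if_true, if_false, Nat.one_lt_ofNat, true_or]
        ring
      · rw [if_neg h4, if_neg h4, if_neg h4]
        by_cases h5 : l = L
        · subst h5
          rw [if_pos rfl, if_pos rfl, if_pos (by omega), if_pos (by omega)]
          ring
        · rw [if_neg h5, if_neg h5]
          split_ifs <;> ring
    rw [h1, h2, hV, hr, Finset.sum_congr rfl h3, Finset.sum_add_distrib, Finset.sum_add_distrib,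
      Finset.sum_ite_eq', Finset.sum_ite_eq', if_pos (by rw [Finset.mem_Icc]; omega),
      if_pos (by rw [Finset.mem_Icc]; omega), gen_row hi hp, if_pos rfl, if_neg (by omega),
      if_neg (by omega), if_pos (by omega), hθ]
    ring
  have hnorm : ∑ l ∈ Finset.Icc 1 N, |a l| ≤ (1 - δ) / 3 + η := by
    rw [← he.2 N a]
    refine lp.norm_le_of_forall_le ?_ fun q => ?_
    · exact (abs_nonneg _).trans (hrow 1)
    · rw [← hcoord]
      exact hrow q
  have hθ' : (1 - δ) / 3 - 1 / 3 * |c L| - 1 / 10 * (|c 0| + |c 1|) ≤ |θ| := by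
    have h0 := abs_le.1 (le_refl |c 0|)
    have h1 := abs_le.1 (le_refl |c 1|)
    have h2 : |(1 - δ) / 3 * c L| ≤ 1 / 3 * |c L| := by
      rw [abs_mul, abs_of_pos (by linarith)]
      gcongr
      linarith
    rw [abs_le] at h2
    obtain ⟨h2l, h2r⟩ := h2
    rcases hi' with rfl | rfl
    · rw [show (-1 : ℝ) ^ (1 - 1) = 1 by norm_num] at hθ
      refine le_trans ?_ (le_abs_self _)
      linarith
    · rw [show (-1 : ℝ) ^ (2 - 1) = -1 by norm_num] at hθ
      refine le_trans ?_ (neg_le_abs _)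
      linarith
  have hpt : ∀ l ∈ Finset.Icc 1 N, |c l| ≤ 10 * |a l| + (if l = 1 then |c 1| - 10 * |θ| else 0) +
      (if l = 2 * n then |c (2 * n)| else 0) + (if l = 2 * n + 1 then |c (2 * n + 1)| else 0) +
      (if l = L then |c L| else 0) := by
    intro l hl
    rw [Finset.mem_Icc] at hl
    have k1 : 0 ≤ if l = 2 * n then |c (2 * n)| else 0 := by split_ifs <;> positivity
    have k2 : 0 ≤ if l = 2 * n + 1 then |c (2 * n + 1)| else 0 := by split_ifs <;> positivity
    have k3 : 0 ≤ if l = L then |c L| else 0 := by split_ifs <;> positivity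
    by_cases h1 : l = 1
    · have : a l = θ := by simp only [ha, if_pos h1]
      rw [this, if_pos h1, h1]
      rw [h1] at k1 k2 k3
      linarith
    · rw [if_neg h1]
      by_cases h2 : l = 2 * n ∨ l = 2 * n + 1 ∨ l = L
      · have h3 : 0 ≤ |a l| := abs_nonneg _
        have h4 : ∀ m, l = m → |c l| = |c m| := fun m hm => by rw [hm]
        rcases h2 with h2 | h2 | h2 <;> rw [if_pos h2, h4 _ h2] <;> linarith
      · have : a l = 1 / 10 * c l := by
          simp only [ha]
          rw [if_neg h1, if_neg (by omega)]
        rw [this, abs_mul, abs_of_pos (by norm_num : (0 : ℝ) < 1 / 10)]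
        linarith
  have hsum := Finset.sum_le_sum hpt
  simp only [Finset.sum_add_distrib, Finset.sum_ite_eq', ← Finset.mul_sum] at hsum
  rw [if_pos (by rw [Finset.mem_Icc]; omega), if_pos (by rw [Finset.mem_Icc]; omega),
    if_pos (by rw [Finset.mem_Icc]; omega), if_pos (by rw [Finset.mem_Icc]; omega)] at hsum
  have hr : ∑ l ∈ Finset.range (N + 1), |c l| = |c 0| + ∑ l ∈ Finset.Icc 1 N, |c l| := by
    rw [Finset.sum_range_succ', add_comm, Finset.range_eq_Ico,
      Finset.sum_Ico_add' (fun l => |c l|) 0 N 1]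
    congr 1
  rw [← hL, hr]
  have := abs_nonneg (c 0)
  have := abs_nonneg (c 1)
  have := abs_nonneg (c L)
  have := abs_nonneg (c (2 * n))
  have := abs_nonneg (c (2 * n + 1))
  linarith

/-- A vector of `X` that is small on the block `n + 1` of the first row is small as soon as adding
it to `V_{i,n+1}` does not enlarge the row `2 (n + 1) + i - 1` by much. The constant does not depend
on `n`. -/
theorem exists_norm_le (he : IsEllOneBasis e) (h : Admissible δ M Δ) :
    ∃ K : ℝ, 0 < K ∧ ∀ (n i : ℕ), 1 ≤ n → i ∈ ({1, 2} : Set ℕ) → ∀ w ∈ X e δ M Δ, ∀ η : ℝ, 0 < η →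
      (∀ k (hk : k ∈ Finset.Icc 1 8), |w (1, coord (n + 1) k hk)| ≤ η) →
      ‖vecV e δ M Δ i (n + 1) + w‖ ≤ (1 - δ) / 3 + η → ‖w‖ ≤ K * η := by
  obtain ⟨K, hK, hKc⟩ := exists_abs_le_of_blockValue h
  refine ⟨21 + 50 * K, by positivity, fun n i hn hi w hw η hη hblock hrow => ?_⟩
  have hi' : i = 1 ∨ i = 2 := hi
  obtain ⟨c, N, hN, hd⟩ := exists_sum_gen_of_mem_X hw hη (2 * n + 3)
  set w' := ∑ l ∈ Finset.range (N + 1), c l • gen e δ M Δ l with hw'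
  have hc := hKc _ (2 * η) (by linarith) fun k hk => by
    rw [← sum_gen_block (e := e) hn hN c hk, ← hw']
    have h1 := (lp.norm_apply_le_norm ENNReal.top_ne_zero (w - w') (1, coord (n + 1) k hk)).trans hd
    have h2 := hblock k hk
    change |w (1, coord (n + 1) k hk) - w' (1, coord (n + 1) k hk)| ≤ η at h1
    rw [abs_le] at h1 h2 ⊢
    constructor <;> linarith
  have c0 := hc 0
  have c1 := hc 1
  have c2 := hc 2
  have c3 := hc 3
  have c4 := hc 4
  have c5 := hc 5
  simp only [Matrix.cons_val] at c0 c1 c2 c3 c4 c5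
  have hsum := sum_abs_le_of_row he h hi hn hN c
    (p := ⟨2 * (n + 1) + i - 1, by omega⟩) rfl (η := 2 * η) fun q => by
      refine (lp.norm_apply_le_norm ENNReal.top_ne_zero (vecV e δ M Δ i (n + 1) + w') _).trans ?_
      rw [show vecV e δ M Δ i (n + 1) + w' = vecV e δ M Δ i (n + 1) + w - (w - w') by abel]
      refine (norm_sub_le _ _).trans ?_
      linarith
  have hU : |c 0| + |c 1| ≤ 2 * (K * (2 * η)) := by
    rcases (show parIdx n = 1 ∨ parIdx n = 2 from parIdx_mem n) with h1 | h1 <;>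
      rw [h1] at c0 c1 <;> norm_num at c0 c1 <;> linarith
  have hL : |c (2 * (n + 1) + i - 1)| ≤ K * (2 * η) := by
    rcases hi' with rfl | rfl
    · exact c4
    · exact c5
  have hw1 : ‖w'‖ ≤ ∑ l ∈ Finset.range (N + 1), |c l| := by
    refine norm_sum_le_of_le _ fun l _ => ?_
    rw [norm_smul, Real.norm_eq_abs]
    exact mul_le_of_le_one_right (abs_nonneg _) (norm_gen_le he h l)
  calc ‖w‖ = ‖w' + (w - w')‖ := by rw [add_sub_cancel]
    _ ≤ ‖w'‖ + ‖w - w'‖ := norm_add_le _ _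
    _ ≤ (21 + 50 * K) * η := by linarith

/-! ### The inductive step -/

/-- If `x - z` attains its norm only at the coordinate `f`, where it has the sign `s`, then a point
`y` that is almost as close to a perturbation `z'` of `z` as `x` is cannot exceed `x` at `f` in the
direction `s`. The size `ε` of the perturbation does not enter the conclusion. -/
theorem mul_apply_sub_le {x y z z' : LInf2} {f : ℕ+ × ℕ+} {s ε η : ℝ} (hs : s = 1 ∨ s = -1)
    (hgap : ∀ c ≠ f, |x c - z c| + 2 * ε ≤ s * (x f - z f)) (hz : ‖z' - z‖ ≤ ε)
    (hy : ‖y - z'‖ ≤ (1 + η) * ‖x - z'‖) :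
    s * (y f - x f) ≤ η * ‖x - z'‖ := by
  have hzc : ∀ c, |z' c - z c| ≤ ε := fun c =>
    (lp.norm_apply_le_norm ENNReal.top_ne_zero (z' - z) c).trans hz
  have hε : 0 ≤ ε := (norm_nonneg _).trans hz
  have hzf := abs_le.1 (hzc f)
  have hpert : s * (x f - z f) - ε ≤ s * (x f - z' f) := by
    rcases hs with rfl | rfl <;> linarith [hzf.1, hzf.2]
  have hpos : 0 ≤ s * (x f - z' f) := by
    have hne : (f.1, f.2 + 1) ≠ f := fun h => by
      have h2 := congrArg (fun c : ℕ+ × ℕ+ => (c.2 : ℕ)) h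
      simp at h2
    linarith [hgap _ hne, abs_nonneg (x (f.1, f.2 + 1) - z (f.1, f.2 + 1))]
  have hx : ‖x - z'‖ ≤ s * (x f - z' f) := by
    refine lp.norm_le_of_forall_le hpos fun c => ?_
    change |x c - z' c| ≤ _
    by_cases hc : c = f
    · subst hc
      rw [abs_le]
      rcases hs with rfl | rfl <;> constructor <;> linarith
    · have h1 := hgap c hc
      have h2 := abs_sub_le (x c) (z c) (z' c)
      rw [abs_sub_comm (z c)] at h2
      linarith [hzc c]
  have hyf : s * (y f - z' f) ≤ ‖y - z'‖ := by
    have h1 := abs_le.1 (lp.norm_apply_le_norm ENNReal.top_ne_zero (y - z') f)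
    obtain ⟨h1l, h1r⟩ := h1
    change y f - z' f ≤ _ at h1r
    change _ ≤ y f - z' f at h1l
    rcases hs with rfl | rfl <;> linarith
  linarith

/-- A convex set that comes `ε`-close to the points `τ • U_i` and `τ • V_{i,n}` comes `ε`-close to
their convex combination `τ • mix n k`. -/
theorem exists_mem_near_mix {e : ℕ → LInf} {δ M Δ : ℝ} (h : Admissible δ M Δ)
    {D : Set (X e δ M Δ)} (hD : Convex ℝ D) {n k : ℕ} (hk : k ∈ Finset.Icc 1 8) {τ ε : ℝ}
    (hU : ∀ i ∈ ({1, 2} : Set ℕ), ∃ z ∈ D, ‖(z : LInf2) - τ • vecU e M Δ i‖ ≤ ε)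
    (hV : ∀ i ∈ ({1, 2} : Set ℕ), ∃ z ∈ D, ‖(z : LInf2) - τ • vecV e δ M Δ i n‖ ≤ ε) :
    ∃ z ∈ D, ‖(z : LInf2) - τ • mix e δ M Δ n k‖ ≤ ε := by
  obtain ⟨a, ha, ha'⟩ := hU (parIdx n) (parIdx_mem n)
  obtain ⟨b, hb, hb'⟩ := hV 1 (by simp)
  obtain ⟨c, hc, hc'⟩ := hV 2 (by simp)
  obtain ⟨ht0, ht1, -⟩ := h.tk_bounds hk
  set t := tk M k with ht
  have h1 : 0 ≤ 1 - t := by linarith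
  have h2 : 0 ≤ t / 2 := by linarith
  have hbc : (1 / 2 : ℝ) • b + (1 / 2 : ℝ) • c ∈ D :=
    hD hb hc (by norm_num) (by norm_num) (by norm_num)
  refine ⟨(1 - t) • a + t • ((1 / 2 : ℝ) • b + (1 / 2 : ℝ) • c),
    hD ha hbc h1 ht0.le (by ring), ?_⟩
  have e1 : (((1 - t) • a + t • ((1 / 2 : ℝ) • b + (1 / 2 : ℝ) • c) : X e δ M Δ) : LInf2) -
      τ • mix e δ M Δ n k =
      (1 - t) • ((a : LInf2) - τ • vecU e M Δ (parIdx n)) +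
        ((t / 2) • ((b : LInf2) - τ • vecV e δ M Δ 1 n) +
          (t / 2) • ((c : LInf2) - τ • vecV e δ M Δ 2 n)) := by
    simp only [Submodule.coe_add, Submodule.coe_smul, mix, ← ht]
    module
  rw [e1]
  calc _ ≤ ‖(1 - t) • ((a : LInf2) - τ • vecU e M Δ (parIdx n))‖ +
        (‖(t / 2) • ((b : LInf2) - τ • vecV e δ M Δ 1 n)‖ +
          ‖(t / 2) • ((c : LInf2) - τ • vecV e δ M Δ 2 n)‖) :=
        (norm_add_le _ _).trans (by gcongr; exact norm_add_le _ _)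
    _ ≤ (1 - t) * ε + (t / 2 * ε + t / 2 * ε) := by
        rw [norm_smul, norm_smul, norm_smul, Real.norm_of_nonneg h1, Real.norm_of_nonneg h2]
        gcongr
    _ = ε := by ring

theorem norm_mix_le {e : ℕ → LInf} (he : IsEllOneBasis e) {δ M Δ : ℝ} (h : Admissible δ M Δ)
    {n k : ℕ} (hn : 1 ≤ n) (hk : k ∈ Finset.Icc 1 8) : ‖mix e δ M Δ n k‖ ≤ 1 := by
  obtain ⟨ht0, ht1, -⟩ := h.tk_bounds hk
  have hU := norm_vecU_le he h (parIdx n)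
  have hδ := h.delta_pos
  have hV : ∀ i ∈ ({1, 2} : Set ℕ), ‖vecV e δ M Δ i n‖ ≤ 1 := fun i hi =>
    (norm_vecV_le he h hi hn).trans (by linarith)
  have hV1 := hV 1 (by simp)
  have hV2 := hV 2 (by simp)
  have h1 : 0 ≤ 1 - tk M k := by linarith
  have h2 : 0 ≤ tk M k / 2 := by linarith
  calc _ ≤ ‖(1 - tk M k) • vecU e M Δ (parIdx n)‖ +
        (‖(tk M k / 2) • vecV e δ M Δ 1 n‖ + ‖(tk M k / 2) • vecV e δ M Δ 2 n‖) :=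
        (norm_add_le _ _).trans (by gcongr; exact norm_add_le _ _)
    _ ≤ (1 - tk M k) * 1 + (tk M k / 2 * 1 + tk M k / 2 * 1) := by
        rw [norm_smul, norm_smul, norm_smul, Real.norm_of_nonneg h1, Real.norm_of_nonneg h2]
        gcongr
    _ = 1 := by ring

/-- The inductive step, for the positive sign: if the convex set `D` comes close enough to
all `± U_i` and `± V_{i,n}`, then an almost nonexpansive retraction onto `D` moves `V_{i,n+1}` by at
most a multiple of the excess `η` of its Lipschitz constant. -/
theorem exists_norm_retract_sub_le {e : ℕ → LInf} (he : IsEllOneBasis e) {δ M Δ : ℝ}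
    (h : Admissible δ M Δ) :
    ∃ C : ℝ, 0 < C ∧ ∀ (D : Set (X e δ M Δ)) (R : X e δ M Δ → X e δ M Δ) (η : ℝ),
      Convex ℝ D → 0 ∈ D → (∀ x ∈ D, R x = x) → 0 < η → (∀ x y, ‖R x - R y‖ ≤ (1 + η) * ‖x - y‖) →
      ∀ (n : ℕ), 1 ≤ n →
      (∀ τ : ℝ, τ = 1 ∨ τ = -1 → ∀ i ∈ ({1, 2} : Set ℕ),
        (∃ z ∈ D, ‖(z : LInf2) - τ • vecU e M Δ i‖ ≤ gap δ M / 2) ∧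
        ∃ z ∈ D, ‖(z : LInf2) - τ • vecV e δ M Δ i n‖ ≤ gap δ M / 2) →
      ∀ (i : ℕ) (hi : i ∈ ({1, 2} : Set ℕ)),
        ‖R (V e δ M Δ i (n + 1) hi (Nat.le_add_left 1 n)) -
          V e δ M Δ i (n + 1) hi (Nat.le_add_left 1 n)‖ ≤ C * η := by
  obtain ⟨K, hK, hKw⟩ := exists_norm_le he h
  refine ⟨K * 2, by positivity, ?_⟩
  intro D R η hD hD0 hR hη hLip n hn hnear i hi
  set x := V e δ M Δ i (n + 1) hi (Nat.le_add_left 1 n) with hx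
  have hxc : (x : LInf2) = vecV e δ M Δ i (n + 1) := rfl
  have hδ := h.delta_pos
  have hδ' := h.delta_lt
  have hxn : ‖(x : LInf2)‖ ≤ (1 - δ) / 3 := norm_vecV_le he h hi (Nat.le_add_left 1 n)
  have hg : gap δ M ≤ δ / 6 := min_le_right _ _
  have hdist : ∀ z ∈ D, ‖(R x : LInf2) - z‖ ≤ (1 + η) * ‖(x : LInf2) - z‖ := fun z hz => by
    have := hLip x z
    rwa [hR z hz] at this
  have hside : ∀ τ : ℝ, τ = 1 ∨ τ = -1 → ∀ k (hk : k ∈ Finset.Icc 1 8),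
      -τ * ((R x : LInf2) (1, coord (n + 1) k hk) - (x : LInf2) (1, coord (n + 1) k hk)) ≤
        2 * η := by
    intro τ hτ k hk
    obtain ⟨z, hz, hzn⟩ := exists_mem_near_mix h hD (n := n) (τ := τ) hk
      (fun i hi => (hnear τ hτ i hi).1) (fun i hi => (hnear τ hτ i hi).2)
    have hs : -τ = 1 ∨ -τ = -1 := by rcases hτ with rfl | rfl <;> simp
    have h1 := mul_apply_sub_le hs
      (fun c hc => by
        have := vecV_sub_mix_apply_le he h hi hn hk hτ hc
        rw [← hxc] at this
        rwa [mul_div_cancel₀ _ (two_ne_zero' ℝ)]) hzn (hdist z hz)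
    have h2 : ‖(x : LInf2) - z‖ ≤ 2 := by
      have h3 : ‖τ • mix e δ M Δ n k‖ ≤ 1 := by
        rw [norm_smul, Real.norm_eq_abs, show |τ| = 1 by rcases hτ with rfl | rfl <;> simp, one_mul]
        exact norm_mix_le he h hn hk
      calc ‖(x : LInf2) - z‖ =
          ‖(x : LInf2) - ((z - τ • mix e δ M Δ n k) + τ • mix e δ M Δ n k)‖ := by
            rw [sub_add_cancel]
        _ ≤ ‖(x : LInf2)‖ + (‖(z : LInf2) - τ • mix e δ M Δ n k‖ + ‖τ • mix e δ M Δ n k‖) :=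
            (norm_sub_le _ _).trans (by gcongr; exact norm_add_le _ _)
        _ ≤ 2 := by linarith
    refine h1.trans ?_
    rw [mul_comm]
    gcongr
  -- the point `0` of `D` is known without error, which bounds the row of `e 1, e 2, …` of `R x`
  have h0 := hdist 0 hD0
  rw [Submodule.coe_zero, sub_zero, sub_zero] at h0
  have := hKw n i hn hi _ (R x - x).2 (2 * η) (by positivity)
    (fun k hk => by
      have h1 := hside 1 (Or.inl rfl) k hk
      have h2 := hside (-1) (Or.inr rfl) k hk
      change |(R x : LInf2) (1, coord (n + 1) k hk) - (x : LInf2) (1, coord (n + 1) k hk)| ≤ _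
      rw [abs_le]
      constructor <;> linarith)
    (by
      rw [← hxc, Submodule.coe_sub, add_sub_cancel]
      refine h0.trans ?_
      have : η * ‖(x : LInf2)‖ ≤ η * ((1 - δ) / 3) := by gcongr
      nlinarith)
  rw [mul_assoc]
  exact this

end RetractSpace

open RetractSpace in
theorem mainTheorem2 (e : ℕ → RetractSpace.LInf) (he : RetractSpace.IsEllOneBasis e)
    (δ M Δ : ℝ) (hpar : RetractSpace.Admissible δ M Δ) :
    ∃ ε₀ C : ℝ, 0 < ε₀ ∧ ε₀ < 1 / 10 ∧ 0 < C ∧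
      ∀ (D : Set (RetractSpace.X e δ M Δ))
        (R : RetractSpace.X e δ M Δ → RetractSpace.X e δ M Δ),
        Convex ℝ D → 0 ∈ D →
        RetractSpace.IsRetractionOnto R D →
        LipschitzWith (Real.toNNReal (1 + ε₀ / C)) R →
        (∀ (i : ℕ) (hi : i ∈ ({1, 2} : Set ℕ)), ∀ j ∈ ({1, 2} : Set ℕ),
          ‖R ((-1 : ℝ) ^ j • RetractSpace.V e δ M Δ i 1 hi le_rfl)
              - (-1 : ℝ) ^ j • RetractSpace.V e δ M Δ i 1 hi le_rfl‖ ≤ ε₀ ∧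
          ‖R ((-1 : ℝ) ^ j • RetractSpace.U e δ M Δ i hi)
              - (-1 : ℝ) ^ j • RetractSpace.U e δ M Δ i hi‖ ≤ ε₀) →
        ∀ (i : ℕ) (hi : i ∈ ({1, 2} : Set ℕ)), ∀ j ∈ ({1, 2} : Set ℕ),
          ∀ (n : ℕ) (hn : 1 ≤ n),
            ‖R ((-1 : ℝ) ^ j • RetractSpace.V e δ M Δ i n hi hn)
              - (-1 : ℝ) ^ j • RetractSpace.V e δ M Δ i n hi hn‖ ≤ ε₀ := by
  obtain ⟨C, hC, hstep⟩ := exists_norm_retract_sub_le he hpar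
  have hg := hpar.gap_pos
  have hg' : gap δ M ≤ δ / 6 := min_le_right _ _
  have hδ := hpar.delta_lt
  -- `2 ε₀` is the gap, so that perturbations of size `ε₀` do not move the dominating coordinate,
  -- and the step loses `C * (ε₀ / C) = ε₀`
  refine ⟨gap δ M / 2, C, by positivity, by linarith, hC, ?_⟩
  intro D R hD hD0 hR hLip hstart
  have hη : 0 < gap δ M / 2 / C := by positivity
  have hLip' : ∀ x y, ‖R x - R y‖ ≤ (1 + gap δ M / 2 / C) * ‖x - y‖ := fun x y => by
    have := hLip.dist_le_mul x y
    rwa [Real.coe_toNNReal _ (by linarith), dist_eq_norm, dist_eq_norm] at this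
  have hCη : C * (gap δ M / 2 / C) = gap δ M / 2 := mul_div_cancel₀ _ hC.ne'
  have hpow : ∀ τ : ℝ, τ = 1 ∨ τ = -1 → ∃ j ∈ ({1, 2} : Set ℕ), (-1 : ℝ) ^ j = τ := by
    rintro τ (rfl | rfl)
    · exact ⟨2, by simp, by norm_num⟩
    · exact ⟨1, by simp, by norm_num⟩
  have hneg : ∀ (τ : ℝ) (a : X e δ M Δ) (w : LInf2), ‖(a : LInf2) - -τ • w‖ ≤ gap δ M / 2 →
      ‖((-a : X e δ M Δ) : LInf2) - τ • w‖ ≤ gap δ M / 2 := fun τ a w ha => by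
    have h1 : ((-a : X e δ M Δ) : LInf2) - τ • w = -((a : LInf2) - -τ • w) := by
      rw [Submodule.coe_neg]
      module
    rwa [h1, norm_neg]
  suffices hall : ∀ n (hn : 1 ≤ n) (i : ℕ) (hi : i ∈ ({1, 2} : Set ℕ)), ∀ j ∈ ({1, 2} : Set ℕ),
      ‖R ((-1 : ℝ) ^ j • V e δ M Δ i n hi hn) - (-1 : ℝ) ^ j • V e δ M Δ i n hi hn‖ ≤
        gap δ M / 2 from fun i hi j hj n hn => hall n hn i hi j hj
  intro n hn
  induction n, hn using Nat.le_induction with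
  | base => exact fun i hi j hj => (hstart i hi j hj).1
  | succ n hn ih =>
    intro i hi j hj
    have hnear : ∀ τ : ℝ, τ = 1 ∨ τ = -1 → ∀ i ∈ ({1, 2} : Set ℕ),
        (∃ z ∈ D, ‖(z : LInf2) - τ • vecU e M Δ i‖ ≤ gap δ M / 2) ∧
        ∃ z ∈ D, ‖(z : LInf2) - τ • vecV e δ M Δ i n‖ ≤ gap δ M / 2 := by
      intro τ hτ i hi
      obtain ⟨j, hj, rfl⟩ := hpow τ hτ
      exact ⟨⟨_, hR.1 _, (hstart i hi j hj).2⟩, ⟨_, hR.1 _, ih i hi j hj⟩⟩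
    rcases hj with rfl | rfl
    · -- the sign is negative: `x ↦ -R (-x)` is a retraction onto `-D`
      have := hstep (-D) (fun x => -R (-x)) _ hD.neg (by simpa using hD0)
        (fun x hx => by rw [hR.2 _ hx, neg_neg]) hη
        (fun x y => by
          rw [neg_sub_neg, norm_sub_rev]
          refine (hLip' _ _).trans (le_of_eq ?_)
          rw [neg_sub_neg, norm_sub_rev]) n hn
        (fun τ hτ i hi => by
          obtain ⟨⟨a, ha, ha'⟩, ⟨b, hb, hb'⟩⟩ := hnear (-τ)
            (by rcases hτ with rfl | rfl <;> simp) i hi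
          exact ⟨⟨-a, by simpa using ha, hneg τ a _ ha'⟩, ⟨-b, by simpa using hb, hneg τ b _ hb'⟩⟩)
        i hi
      rw [hCη] at this
      rwa [pow_one, neg_one_smul, sub_neg_eq_add, ← norm_neg, neg_add']
    · have := hstep D R _ hD hD0 hR.2 hη hLip' n hn hnear i hi
      rw [hCη] at this
      rwa [neg_one_sq, one_smul]
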